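/- Smoothness is understood in the sense of Michal--Bastiani: a map between open subsets of Hausdorff locally convex spaces is smooth if all its iterated directional derivatives exist and are jointly continuous. Locally convex manifolds are Hausdorff manifolds modelled on a Hausdorff locally convex space with smooth chart changes; locally convex Lie groups are groups that are such manifolds with smooth multiplication and inversion. Let $G$ be a (real) locally convex Lie group with Lie algebra $\mathfrak{g} = T_{\mathbf 1}G$, the bracket being that of left invariant vector fields. Let $\mathcal{M}$ be a locally convex manifold with a symplectic form $\Omega$, i.e. a smooth closed $2$-form that is weakly nondegenerate ($\Omega_m(v,w)=0$ for all $w \in T_m\mathcal{M}$ implies $v=0$). Let $\alpha \colon G\times\mathcal{M}\to\mathcal{M}$ be a symplectic action, i.e. an action such that every orbit map $G \to \mathcal{M}$, $g\mapsto\alpha_g(m)$, and every map $\alpha_g\colon\mathcal{M}\to\mathcal{M}$ is smooth, and $\alpha_g^*\Omega=\Omega$ for all $g\in G$ (the action map is not assumed to be jointly smooth). For $\xi\in\mathfrak{g}$, let $X_\xi(m)\in T_m\mathcal{M}$ be the derivative at $\mathbf 1$ in the direction $\xi$ of the orbit map $g\mapsto\alpha_g(m)$. Then for every $m\in\mathcal{M}$,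 the map \[\omega_m\colon\mathfrak{g}\times\mathfrak{g}\to\mathbb{R},\qquad \omega_m(\xi,\eta)=\Omega_m(X_\xi(m),X_\eta(m)),\] is a continuous Lie algebra $2$-cocycle: it is jointly continuous, bilinear and alternating, and \[\omega_m([\xi,\eta],\zeta)+\omega_m([\eta,\zeta],\xi)+\omega_m([\zeta,\xi],\eta)=0\qquad(\xi,\eta,\zeta\in\mathfrak{g}).\] If moreover $(\mathcal{M},\Omega)$ is a Kähler manifold, i.e. $\mathcal{M}$ is a complex manifold modelled on a complex locally convex space and $\Omega=\mathrm{Im}\,H$ for a smooth positive definite Hermitian form $H$ on the tangent spaces (antilinear in the first and linear in the second argument), then for every $m \in \mathcal{M}$ there is a continuous, positive semidefinite Hermitian form $h_m\colon\mathfrak{g}_{\mathbb{C}}\times\mathfrak{g}_{\mathbb{C}}\to\mathbb{C}$ (antilinear in the first and linear in the second argument) such that $\omega_m(\xi,\eta)=\mathrm{Im}\,h_m(\xi,\eta)$ for all $\xi,\eta\in\mathfrak{g}$. -/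

import Mathlib

open Set Filter Topology
open scoped ComplexConjugate

noncomputable section

/-! ### Michal--Bastiani calculus in topological vector spaces -/

section Calculus

variable (𝕜 : Type*) [NontriviallyNormedField 𝕜]
  {E : Type*} [AddCommGroup E] [Module 𝕜 E]
  {F : Type*} [AddCommGroup F] [Module 𝕜 F] [TopologicalSpace F]

/-- `w` is the derivative of `f` at `x` in the direction `v`. -/
def HasDirDeriv (f : E → F) (x v : E) (w : F) : Prop :=
  Tendsto (fun t : 𝕜 => t⁻¹ • (f (x + t • v) - f x)) (𝓝[≠] 0) (𝓝 w)

open Classical in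
/-- The derivative of `f` at `x` in the direction `v` (zero if it does not exist). -/
def dirDeriv (f : E → F) (x v : E) : F :=
  if h : ∃ w, HasDirDeriv 𝕜 f x v w then h.choose else 0

/-- The iterated directional derivative
`d^k f (x; v₀, …, v_{k-1}) = (D_{v_{k-1}} ⋯ D_{v₀} f)(x)`. -/
def iterDirDeriv (f : E → F) : (k : ℕ) → E → (Fin k → E) → F
  | 0, x, _ => f x
  | k + 1, x, v =>
      dirDeriv 𝕜 (fun y => iterDirDeriv f k y (Fin.init v)) x (v (Fin.last k))

/-- `f` is smooth on the open set `U` in the sense of Michal--Bastiani: all iterated directional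
derivatives exist on `U`, and each `d^k f : U × E^k → F` is (jointly) continuous.
For `𝕜 = ℂ` this is holomorphy. -/
def MBSmoothOn [TopologicalSpace E] (f : E → F) (U : Set E) : Prop :=
  ∀ k : ℕ,
    (∀ x ∈ U, ∀ v : Fin (k + 1) → E, ∃ w,
      HasDirDeriv 𝕜 (fun y => iterDirDeriv 𝕜 f k y (Fin.init v)) x (v (Fin.last k)) w) ∧
    ContinuousOn (fun p : E × (Fin k → E) => iterDirDeriv 𝕜 f k p.1 p.2) (U ×ˢ univ)

end Calculus

/-! ### Manifolds modelled on a topological vector space -/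

section Manifolds

variable (𝕜 : Type*) [NontriviallyNormedField 𝕜]
  (E : Type*) [AddCommGroup E] [Module 𝕜 E] [TopologicalSpace E]
  (F : Type*) [AddCommGroup F] [Module 𝕜 F] [TopologicalSpace F]
  {M : Type*} [TopologicalSpace M] [ChartedSpace E M]
  {N : Type*} [TopologicalSpace N] [ChartedSpace F N]

/-- The atlas of `M` makes it a (Hausdorff) manifold modelled on `E`: all chart changes are smooth.
For `𝕜 = ℂ` this is a complex manifold, with a holomorphic atlas. -/
structure IsLCManifold (M : Type*) [TopologicalSpace M] [ChartedSpace E M] : Prop where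
  t2 : T2Space M
  smooth_transition : ∀ e ∈ atlas E M, ∀ e' ∈ atlas E M,
    MBSmoothOn 𝕜 (fun x => e' (e.symm x)) (e.target ∩ e.symm ⁻¹' e'.source)

/-- Smooth maps between manifolds: continuous, and smooth in all charts. -/
def LCSmooth (f : M → N) : Prop :=
  Continuous f ∧ ∀ e ∈ atlas E M, ∀ e' ∈ atlas F N,
    MBSmoothOn 𝕜 (fun x => e' (f (e.symm x)))
      (e.target ∩ e.symm ⁻¹' (f ⁻¹' e'.source))

/-- The tangent space `T_m M`, identified with the model space by the preferred chart at `m`. -/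
abbrev LCTangent (_m : M) : Type _ := E

variable {E F}

/-- The tangent map `T_p f : T_p M → T_q N` of a map `f` with `f p = q`. -/
def lcTangentMap (f : M → N) {p : M} {q : N} (_h : f p = q) (v : LCTangent E p) :
    LCTangent F q :=
  dirDeriv 𝕜 (fun x => chartAt F q (f ((chartAt E p).symm x))) (chartAt E p p) v

/-- The tangent vector at `e.symm x` whose coordinate in the chart `e` is `u`. -/
def tangentOfCoord (e : OpenPartialHomeomorph M E) (x u : E) : LCTangent E (e.symm x) :=
  dirDeriv 𝕜 (fun y => chartAt E (e.symm x) (e.symm y)) x u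

/-- The expression of a vector field in the chart `e`. -/
def fieldInChart (e : OpenPartialHomeomorph M E) (X : (m : M) → LCTangent E m) (x : E) : E :=
  dirDeriv 𝕜 (fun y => e ((chartAt E (e.symm x)).symm y))
    (chartAt E (e.symm x) (e.symm x)) (X (e.symm x))

/-- The Lie bracket `[X, Y] = DY(X) - DX(Y)` of vector fields, computed in the preferred chart
at each point. -/
def fieldBracket (X Y : (m : M) → LCTangent E m) (m : M) : LCTangent E m :=
  dirDeriv 𝕜 (fieldInChart 𝕜 (chartAt E m) Y) (chartAt E m m) (X m)
    - dirDeriv 𝕜 (fieldInChart 𝕜 (chartAt E m) X) (chartAt E m m) (Y m)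

end Manifolds

/-! ### Locally convex Lie groups and their Lie algebra -/

section LieGroups

variable (𝔤 : Type*) [AddCommGroup 𝔤] [Module ℝ 𝔤] [TopologicalSpace 𝔤]
  (G : Type*) [TopologicalSpace G] [ChartedSpace 𝔤 G] [Group G]

/-- Lie groups modelled on `𝔤`: manifolds whose multiplication `G × G → G` and inversion are
smooth.  The charts of `G × G` are the products of charts of `G`. -/
structure IsLCLieGroup : Prop where
  manifold : IsLCManifold ℝ 𝔤 G
  continuous_mul : Continuous (fun p : G × G => p.1 * p.2)
  smooth_mul : ∀ e₁ ∈ atlas 𝔤 G, ∀ e₂ ∈ atlas 𝔤 G, ∀ e₃ ∈ atlas 𝔤 G,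
    MBSmoothOn ℝ (fun p : 𝔤 × 𝔤 => e₃ (e₁.symm p.1 * e₂.symm p.2))
      {p | p.1 ∈ e₁.target ∧ p.2 ∈ e₂.target ∧ e₁.symm p.1 * e₂.symm p.2 ∈ e₃.source}
  smooth_inv : LCSmooth ℝ 𝔤 𝔤 (fun g : G => g⁻¹)

variable {𝔤}

/-- The left invariant vector field on `G` with value `ξ` at the identity. -/
def leftInvariantField (ξ : LCTangent 𝔤 (1 : G)) (g : G) : LCTangent 𝔤 g :=
  lcTangentMap ℝ (fun h : G => g * h) (mul_one g) ξ

/-- The Lie bracket on the Lie algebra `T_1 G` of `G`: the value at the identity of the bracket of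
the left invariant vector fields. -/
def lieAlgBracket (ξ η : LCTangent 𝔤 (1 : G)) : LCTangent 𝔤 (1 : G) :=
  fieldBracket ℝ (leftInvariantField G ξ) (leftInvariantField G η) 1

end LieGroups

/-- Continuous real-valued 2-cocycles for a bracket `br` on a topological vector space: continuous
alternating bilinear maps that satisfy the cocycle identity. -/
structure IsContinuousTwoCocycle {V : Type*} [AddCommGroup V] [Module ℝ V] [TopologicalSpace V]
    (br : V → V → V) (ω : V → V → ℝ) : Prop where
  linear_left : ∀ η, IsLinearMap ℝ (fun ξ => ω ξ η)
  linear_right : ∀ ξ, IsLinearMap ℝ (fun η => ω ξ η)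
  alternating : ∀ ξ, ω ξ ξ = 0
  continuous : Continuous (fun p : V × V => ω p.1 p.2)
  cocycle : ∀ ξ η ζ, ω (br ξ η) ζ + ω (br η ζ) ξ + ω (br ζ ξ) η = 0

/-! ### Symplectic forms and symplectic actions -/

section Symplectic

variable {E : Type*} [AddCommGroup E] [Module ℝ E] [TopologicalSpace E]
  {M : Type*} [TopologicalSpace M] [ChartedSpace E M]

/-- The expression in the chart `e` of a field of (real) bilinear or sesquilinear forms `B` on the
tangent spaces. -/
def formInChart {R : Type*} (B : (m : M) → LCTangent E m → LCTangent E m → R)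
    (e : OpenPartialHomeomorph M E) (x u v : E) : R :=
  B (e.symm x) (tangentOfCoord ℝ e x u) (tangentOfCoord ℝ e x v)

/-- Symplectic forms: smooth 2-forms that are closed and (weakly) nondegenerate. -/
structure IsSymplecticForm
    (Ω : (m : M) → LCTangent E m →ₗ[ℝ] LCTangent E m →ₗ[ℝ] ℝ) : Prop where
  alternating : ∀ m v, Ω m v v = 0
  smooth : ∀ e ∈ atlas E M,
    MBSmoothOn ℝ (fun p : E × E × E => formInChart (fun m u v => Ω m u v) e p.1 p.2.1 p.2.2)
      (e.target ×ˢ univ)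
  closed : ∀ e ∈ atlas E M, ∀ x ∈ e.target, ∀ u v w : E,
    dirDeriv ℝ (fun y => formInChart (fun m u v => Ω m u v) e y v w) x u
      + dirDeriv ℝ (fun y => formInChart (fun m u v => Ω m u v) e y w u) x v
      + dirDeriv ℝ (fun y => formInChart (fun m u v => Ω m u v) e y u v) x w = 0
  nondegenerate : ∀ m v, (∀ w, Ω m v w = 0) → v = 0

/-- Symplectic actions: separately smooth actions by maps that preserve `Ω`. -/
structure IsSymplecticAction (𝔤 : Type*) [AddCommGroup 𝔤] [Module ℝ 𝔤] [TopologicalSpace 𝔤]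
    (G : Type*) [TopologicalSpace G] [ChartedSpace 𝔤 G] [Group G] [MulAction G M]
    (Ω : (m : M) → LCTangent E m →ₗ[ℝ] LCTangent E m →ₗ[ℝ] ℝ) : Prop where
  smooth_orbitMap : ∀ m : M, LCSmooth ℝ 𝔤 E (fun g : G => g • m)
  smooth_smul : ∀ g : G, LCSmooth ℝ E E (fun m : M => g • m)
  preserves : ∀ (g : G) (m : M) (u v : LCTangent E m),
    Ω (g • m) (lcTangentMap ℝ (fun m' : M => g • m') rfl u)
      (lcTangentMap ℝ (fun m' : M => g • m') rfl v) = Ω m u v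

variable {𝔤 : Type*} [AddCommGroup 𝔤] [Module ℝ 𝔤] [TopologicalSpace 𝔤]
  {G : Type*} [TopologicalSpace G] [ChartedSpace 𝔤 G] [Group G] [MulAction G M]

/-- The fundamental vector field `X_ξ`: at `m`, the derivative at the identity in the direction `ξ`
of the orbit map `g ↦ g • m`. -/
def fundamentalField (ξ : LCTangent 𝔤 (1 : G)) (m : M) : LCTangent E m :=
  lcTangentMap ℝ (fun g : G => g • m) (one_smul G m) ξ

variable (G) in
/-- The form `ω_m(ξ, η) = Ω_m(X_ξ, X_η)` on the Lie algebra of `G`. -/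
def kostantSouriau (Ω : (m : M) → LCTangent E m →ₗ[ℝ] LCTangent E m →ₗ[ℝ] ℝ) (m : M)
    (ξ η : LCTangent 𝔤 (1 : G)) : ℝ :=
  Ω m (fundamentalField ξ m) (fundamentalField η m)

end Symplectic

/-! ### Kähler manifolds -/

/-- `(M, Ω)` is a Kähler manifold: `M` is a complex manifold, and the symplectic form `Ω` is the
imaginary part of a smooth positive definite Hermitian form `H` on the tangent spaces
(antilinear in the first variable and linear in the second). -/
def IsKahler {E : Type*} [AddCommGroup E] [Module ℝ E] [Module ℂ E] [TopologicalSpace E]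
    {M : Type*} [TopologicalSpace M] [ChartedSpace E M]
    (Ω : (m : M) → LCTangent E m →ₗ[ℝ] LCTangent E m →ₗ[ℝ] ℝ) : Prop :=
  IsLCManifold ℂ E M ∧ IsSymplecticForm Ω ∧
  ∃ H : (m : M) → LCTangent E m →ₗ⋆[ℂ] LCTangent E m →ₗ[ℂ] ℂ,
    (∀ e ∈ atlas E M,
      MBSmoothOn ℝ (fun p : E × E × E => formInChart (fun m u v => H m u v) e p.1 p.2.1 p.2.2)
        (e.target ×ˢ univ)) ∧
    (∀ m u v, H m v u = conj (H m u v)) ∧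
    (∀ m v, v ≠ 0 → 0 < (H m v v).re) ∧
    (∀ m u v, Ω m u v = (H m u v).im)

/-! ### Complexification -/

/-- The complexification `V_ℂ` of a real topological vector space: the pair `(v, w)` stands for
`v + i w`, and the topology is that of `V × V`. -/
def Complexified (V : Type*) : Type _ := V × V

namespace Complexified

variable {V : Type*}

instance [AddCommGroup V] : AddCommGroup (Complexified V) :=
  inferInstanceAs (AddCommGroup (V × V))

instance [TopologicalSpace V] : TopologicalSpace (Complexified V) :=
  inferInstanceAs (TopologicalSpace (V × V))

instance [AddCommGroup V] [Module ℝ V] : Module ℂ (Complexified V) where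
  smul z p := (z.re • p.1 - z.im • p.2, z.re • p.2 + z.im • p.1)
  one_smul p := by
    refine Prod.ext ?_ ?_
    · change (1 : ℂ).re • p.1 - (1 : ℂ).im • p.2 = p.1
      simp
    · change (1 : ℂ).re • p.2 + (1 : ℂ).im • p.1 = p.2
      simp
  mul_smul z w p := by
    refine Prod.ext ?_ ?_
    · change (z * w).re • p.1 - (z * w).im • p.2 =
        z.re • (w.re • p.1 - w.im • p.2) - z.im • (w.re • p.2 + w.im • p.1)
      rw [Complex.mul_re, Complex.mul_im]
      module
    · change (z * w).re • p.2 + (z * w).im • p.1 =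
        z.re • (w.re • p.2 + w.im • p.1) + z.im • (w.re • p.1 - w.im • p.2)
      rw [Complex.mul_re, Complex.mul_im]
      module
  smul_zero z := by
    refine Prod.ext ?_ ?_
    · change z.re • (0 : V) - z.im • (0 : V) = 0
      simp
    · change z.re • (0 : V) + z.im • (0 : V) = 0
      simp
  smul_add z p q := by
    refine Prod.ext ?_ ?_
    · change z.re • (p.1 + q.1) - z.im • (p.2 + q.2) =
        (z.re • p.1 - z.im • p.2) + (z.re • q.1 - z.im • q.2)
      module
    · change z.re • (p.2 + q.2) + z.im • (p.1 + q.1) =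
        (z.re • p.2 + z.im • p.1) + (z.re • q.2 + z.im • q.1)
      module
  add_smul z w p := by
    refine Prod.ext ?_ ?_
    · change (z + w).re • p.1 - (z + w).im • p.2 =
        (z.re • p.1 - z.im • p.2) + (w.re • p.1 - w.im • p.2)
      rw [Complex.add_re, Complex.add_im]
      module
    · change (z + w).re • p.2 + (z + w).im • p.1 =
        (z.re • p.2 + z.im • p.1) + (w.re • p.2 + w.im • p.1)
      rw [Complex.add_re, Complex.add_im]
      module
  zero_smul p := by
    refine Prod.ext ?_ ?_
    · change (0 : ℂ).re • p.1 - (0 : ℂ).im • p.2 = 0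
      simp
    · change (0 : ℂ).re • p.2 + (0 : ℂ).im • p.1 = 0
      simp

/-- The inclusion `V → V_ℂ`. -/
def ofReal [Zero V] (v : V) : Complexified V := (v, 0)

end Complexified

end

/-! The orbit map `g ↦ g • m` intertwines left translation by `g` on `G` with the action of `g` on
`M`. It therefore sends the left invariant field of `ξ` at `g` to the image of `X_ξ(m)` under the
tangent map of `g`. Since `Ω` is invariant, its pullback to `G` is constant on pairs of left
invariant fields, with value `ω_m(ξ, η)`: `ω_m` is the value at the identity of a closed left
invariant 2-form, and closedness of such a form is the cocycle identity. Joint smoothness of the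
action is not needed, because each differentiation involves a single orbit map or a single group
element.

In charts (`cocycle_of_pullback_const`), the constant `B (F x) (dF L_ξ) (dF L_η)` is differentiated
at the identity in the direction `ζ` and the result is summed cyclically. The derivatives of `B`
cancel by closedness, the second derivatives of `F` by Schwarz and antisymmetry, and the derivatives
of the fields `L_ξ` combine into brackets. Equivariance is
`IsSymplecticAction.lcTangentMap_fundamentalField`, and the constancy is
`formInChart_orbitMapInChart`.

The calculus (linearity of the derivative, chain rule, Schwarz) rests on a mean value theorem
obtained from Hahn--Banach separation.

In the Kähler case `h_m` is the pullback of `H_m` along the complex linear extension of `ξ ↦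
X_ξ(m)`. -/

section DirectionalCalculus

/-! ### Michal--Bastiani calculus: mean value theorem, chain rule, Schwarz's theorem. -/

variable {E : Type*} [AddCommGroup E] [Module ℝ E]
  {F : Type*} [AddCommGroup F] [Module ℝ F] [TopologicalSpace F]

theorem HasDirDeriv.unique [T2Space F] {f : E → F} {x v : E} {w w' : F}
    (h : HasDirDeriv ℝ f x v w) (h' : HasDirDeriv ℝ f x v w') : w = w' :=
  tendsto_nhds_unique h h'

theorem hasDirDeriv_dirDeriv {f : E → F} {x v : E} (h : ∃ w, HasDirDeriv ℝ f x v w) :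
    HasDirDeriv ℝ f x v (dirDeriv ℝ f x v) := by
  rw [dirDeriv, dif_pos h]
  exact h.choose_spec

theorem HasDirDeriv.dirDeriv_eq [T2Space F] {f : E → F} {x v : E} {w : F}
    (h : HasDirDeriv ℝ f x v w) : dirDeriv ℝ f x v = w :=
  (hasDirDeriv_dirDeriv ⟨w, h⟩).unique h

theorem HasDirDeriv.congr_of_eventuallyEq {f g : E → F} {x v : E} {w : F}
    (h : HasDirDeriv ℝ f x v w) (hfg : ∀ᶠ t : ℝ in 𝓝[≠] 0, f (x + t • v) = g (x + t • v))
    (hx : f x = g x) : HasDirDeriv ℝ g x v w := by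
  refine Tendsto.congr' ?_ h
  filter_upwards [hfg] with t ht
  rw [ht, hx]

/-- A directional derivative only depends on the restriction of the function to a line, after any
reparametrisation of the domain that is affine along the line. -/
theorem HasDirDeriv.comp_line {E' : Type*} [AddCommGroup E'] [Module ℝ E'] {f : E → F} {x v : E}
    {w : F} (h : HasDirDeriv ℝ f x v w) {g : E' → E} {x' v' : E'}
    (hg : ∀ t : ℝ, g (x' + t • v') = x + t • v) : HasDirDeriv ℝ (fun y => f (g y)) x' v' w := by
  have h0 : g x' = x := by simpa using hg 0
  refine Tendsto.congr (fun t => ?_) h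
  simp only [hg, h0]

theorem hasDirDeriv_const [IsTopologicalAddGroup F] (c : F) (x v : E) :
    HasDirDeriv ℝ (fun _ : E => c) x v 0 := by
  refine Tendsto.congr (fun t => ?_) tendsto_const_nhds
  simp

theorem hasDirDeriv_id [TopologicalSpace E] (x v : E) : HasDirDeriv ℝ (fun y : E => y) x v v := by
  refine Tendsto.congr' ?_ tendsto_const_nhds
  filter_upwards [self_mem_nhdsWithin] with t ht
  rw [add_sub_cancel_left, inv_smul_smul₀ ht]

theorem HasDirDeriv.smul_dir [ContinuousConstSMul ℝ F] {f : E → F} {x v : E} {w : F}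
    (h : HasDirDeriv ℝ f x v w) (c : ℝ) : HasDirDeriv ℝ f x (c • v) (c • w) := by
  rcases eq_or_ne c 0 with rfl | hc
  · refine Tendsto.congr (fun t => ?_) tendsto_const_nhds
    simp
  -- The substitution `t ↦ t * c` preserves the punctured neighbourhoods of 0 only for `c ≠ 0`.
  · have hl : Tendsto (fun t : ℝ => t * c) (𝓝[≠] 0) (𝓝[≠] 0) := by
      refine tendsto_nhdsWithin_iff.2 ⟨?_, ?_⟩
      · have : Tendsto (fun t : ℝ => t * c) (𝓝 0) (𝓝 (0 * c)) := (continuous_mul_const c).tendsto 0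
        rw [zero_mul] at this
        exact this.mono_left nhdsWithin_le_nhds
      · filter_upwards [self_mem_nhdsWithin] with t ht using mul_ne_zero ht hc
    refine Tendsto.congr (fun t => ?_) ((h.comp hl).const_smul c)
    simp only [Function.comp_apply, smul_smul, mul_inv]
    congr 1
    field_simp

theorem HasDirDeriv.hasDerivAt_comp {f : E → F} {x v : E} {w : F} {s : ℝ}
    (h : HasDirDeriv ℝ f (x + s • v) v w) (l : F →L[ℝ] ℝ) :
    HasDerivAt (fun r : ℝ => l (f (x + r • v))) (l w) s := by
  rw [hasDerivAt_iff_tendsto_slope_zero]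
  refine Tendsto.congr (fun t => ?_) ((l.continuous.tendsto w).comp h)
  simp [add_smul, add_assoc]

section

variable [TopologicalSpace E]

/-- Once continuously differentiable functions in the sense of Michal--Bastiani. -/
structure MBC1On (f : E → F) (U : Set E) : Prop where
  hasDirDeriv : ∀ x ∈ U, ∀ v, HasDirDeriv ℝ f x v (dirDeriv ℝ f x v)
  continuousOn : ContinuousOn (fun p : E × E => dirDeriv ℝ f p.1 p.2) (U ×ˢ univ)

theorem MBSmoothOn.mbC1On {f : E → F} {U : Set E} (h : MBSmoothOn ℝ f U) : MBC1On f U where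
  hasDirDeriv x hx v := hasDirDeriv_dirDeriv ((h 0).1 x hx (fun _ => v))
  continuousOn := (h 1).2.comp (f := fun p : E × E => (p.1, fun _ : Fin 1 => p.2))
    (by fun_prop) (fun p hp => ⟨hp.1, mem_univ _⟩)

theorem MBSmoothOn.mbC1On_dirDeriv {f : E → F} {U : Set E} (h : MBSmoothOn ℝ f U) (v : E) :
    MBC1On (fun x => dirDeriv ℝ f x v) U where
  hasDirDeriv x hx w := hasDirDeriv_dirDeriv ((h 1).1 x hx ![v, w])
  continuousOn := (h 2).2.comp (f := fun p : E × E => (p.1, ![v, p.2]))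
    (by fun_prop) (fun p hp => ⟨hp.1, mem_univ _⟩)

theorem MBSmoothOn.continuousOn {f : E → F} {U : Set E} (h : MBSmoothOn ℝ f U) :
    ContinuousOn f U :=
  (h 0).2.comp (f := fun x : E => (x, fun _ : Fin 0 => (0 : E)))
    (by fun_prop) (fun p hp => ⟨hp, mem_univ _⟩)

theorem MBC1On.dirDeriv_smul [T2Space F] [ContinuousConstSMul ℝ F] {f : E → F}
    {U : Set E} (h : MBC1On f U) {x : E} (hx : x ∈ U) (c : ℝ) (v : E) :
    dirDeriv ℝ f x (c • v) = c • dirDeriv ℝ f x v :=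
  ((h.hasDirDeriv x hx v).smul_dir c).dirDeriv_eq

theorem MBC1On.continuous_dirDeriv {f : E → F} {U : Set E} (h : MBC1On f U)
    {x : E} (hx : x ∈ U) : Continuous (dirDeriv ℝ f x) :=
  h.continuousOn.comp_continuous (f := fun v : E => (x, v)) (by fun_prop)
    fun _ => ⟨hx, mem_univ _⟩

end

variable [IsTopologicalAddGroup F] [ContinuousSMul ℝ F] [LocallyConvexSpace ℝ F]

/-- The mean value theorem: difference quotients lie in every closed convex set that contains the
derivatives. -/
theorem differenceQuotient_mem_of_hasDirDeriv {f : E → F} {x v : E} {t : ℝ} (ht : t ≠ 0)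
    {C : Set F} (hC : Convex ℝ C) (hC' : IsClosed C)
    (h : ∀ s : ℝ, |s| ≤ |t| → ∃ w ∈ C, HasDirDeriv ℝ f (x + s • v) v w) :
    t⁻¹ • (f (x + t • v) - f x) ∈ C := by
  by_contra hn
  -- A functional separating the quotient from `C` reduces the claim to the scalar mean value
  -- theorem.
  obtain ⟨l, u, hlu, hl⟩ := geometric_hahn_banach_point_closed hC hC' hn
  choose! w hwC hw using h
  have hder : ∀ s : ℝ, |s| ≤ |t| → HasDerivAt (fun r : ℝ => l (f (x + r • v))) (l (w s)) s :=
    fun s hs => (hw s hs).hasDerivAt_comp l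
  have habs : ∀ c ∈ Icc (0 : ℝ) 1, |c * t| ≤ |t| := fun c hc => by
    rw [abs_mul, abs_of_nonneg hc.1]
    exact mul_le_of_le_one_left (abs_nonneg t) hc.2
  have hder' : ∀ c ∈ Icc (0 : ℝ) 1,
      HasDerivAt (fun r : ℝ => l (f (x + (r * t) • v))) (l (w (c * t)) * t) c := fun c hc =>
    HasDerivAt.comp (h := fun r : ℝ => r * t) c (hder _ (habs c hc)) (hasDerivAt_mul_const t)
  -- Rescaling the segment to `[0, 1]` treats both signs of `t` at once.
  obtain ⟨c, hc, hc'⟩ := exists_hasDerivAt_eq_slope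
    (fun r : ℝ => l (f (x + (r * t) • v))) (fun c => l (w (c * t)) * t) zero_lt_one
    (fun c hc => (hder' c hc).continuousAt.continuousWithinAt)
    (fun c hc => hder' c (Ioo_subset_Icc_self hc))
  have h1 := hl _ (hwC (c * t) (habs c (Ioo_subset_Icc_self hc)))
  simp only [one_mul, zero_mul, zero_smul, add_zero, sub_zero, div_one] at hc'
  rw [map_smul, map_sub, ← hc', smul_eq_mul, mul_comm, mul_assoc, mul_inv_cancel₀ ht, mul_one] at hlu
  exact lt_asymm h1 hlu

theorem exists_closed_convex_nhds_subset {y : F} {V : Set F} (hV : V ∈ 𝓝 y) :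
    ∃ C ∈ 𝓝 y, IsClosed C ∧ Convex ℝ C ∧ C ⊆ V := by
  obtain ⟨N, ⟨hN, hNc⟩, hNV⟩ := (closed_nhds_basis y).mem_iff.1 hV
  obtain ⟨C, ⟨hC, hCc⟩, hCN⟩ := (LocallyConvexSpace.convex_basis (𝕜 := ℝ) y).mem_iff.1 hN
  exact ⟨closure C, mem_of_superset hC subset_closure, isClosed_closure, hCc.closure,
    (closure_minimal hCN hNc).trans hNV⟩

variable [TopologicalSpace E] [IsTopologicalAddGroup E] [ContinuousSMul ℝ E]

theorem tendsto_add_smul_nhds (x v : E) : Tendsto (fun t : ℝ => x + t • v) (𝓝[≠] 0) (𝓝 x) := by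
  have : Tendsto (fun t : ℝ => x + t • v) (𝓝 0) (𝓝 (x + (0 : ℝ) • v)) :=
    Continuous.tendsto (by fun_prop) 0
  rw [zero_smul, add_zero] at this
  exact this.mono_left nhdsWithin_le_nhds

/-- Near the base point, a property of points and directions holds along all short segments. -/
theorem eventually_forall_segment {x v : E} {p : E × E → Prop} (hp : ∀ᶠ q in 𝓝 (x, v), p q) :
    ∀ᶠ q : (E × E) × ℝ in 𝓝 (x, v) ×ˢ 𝓝[≠] (0 : ℝ),
      ∀ s : ℝ, |s| ≤ |q.2| → p (q.1.1 + s • q.1.2, q.1.2) := by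
  have hc : Tendsto (fun q : (E × E) × ℝ => (q.1.1 + q.2 • q.1.2, q.1.2))
      (𝓝 (x, v) ×ˢ 𝓝 (0 : ℝ)) (𝓝 (x, v)) := by
    rw [← nhds_prod_eq]
    have : Tendsto (fun q : (E × E) × ℝ => (q.1.1 + q.2 • q.1.2, q.1.2))
      (𝓝 ((x, v), (0 : ℝ))) (𝓝 (x + (0 : ℝ) • v, v)) := Continuous.tendsto (by fun_prop) _
    simpa using this
  obtain ⟨pa, ha, pb, hb, hab⟩ := eventually_prod_iff.1 (hc.eventually hp)
  obtain ⟨ε, hε, hball⟩ := Metric.eventually_nhds_iff.1 hb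
  have hsmall : ∀ᶠ t : ℝ in 𝓝[≠] 0, |t| < ε := by
    refine Filter.Eventually.filter_mono nhdsWithin_le_nhds ?_
    filter_upwards [Metric.ball_mem_nhds (0 : ℝ) hε] with t ht
    simpa using ht
  filter_upwards [ha.prod_mk hsmall] with q hq s hs
  exact hab hq.1 (hball (by simpa using hs.trans_lt hq.2))

/-- The difference quotients of a continuously differentiable function converge jointly in the base
point, the direction and the increment. -/
theorem MBC1On.tendsto_differenceQuotient {f : E → F} {U : Set E} (h : MBC1On f U)
    (hU : IsOpen U) {x : E} (hx : x ∈ U) (v : E) :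
    Tendsto (fun q : (E × E) × ℝ => q.2⁻¹ • (f (q.1.1 + q.2 • q.1.2) - f q.1.1))
      (𝓝 (x, v) ×ˢ 𝓝[≠] (0 : ℝ)) (𝓝 (dirDeriv ℝ f x v)) := by
  refine tendsto_def.2 fun V hV => ?_
  obtain ⟨C, hC, hCc, hCx, hCV⟩ := exists_closed_convex_nhds_subset hV
  have hopen : U ×ˢ (univ : Set E) ∈ 𝓝 (x, v) :=
    (hU.prod isOpen_univ).mem_nhds ⟨hx, mem_univ _⟩
  have hev : ∀ᶠ q : E × E in 𝓝 (x, v), q.1 ∈ U ∧ dirDeriv ℝ f q.1 q.2 ∈ C := by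
    filter_upwards [hopen, (h.continuousOn.continuousAt hopen).preimage_mem_nhds hC] with q h1 h2
    exact ⟨h1.1, h2⟩
  have hne : ∀ᶠ q : (E × E) × ℝ in 𝓝 (x, v) ×ˢ 𝓝[≠] (0 : ℝ), q.2 ≠ 0 :=
    tendsto_snd.eventually self_mem_nhdsWithin
  filter_upwards [eventually_forall_segment hev, hne] with q hq hq0
  exact hCV (differenceQuotient_mem_of_hasDirDeriv hq0 hCx hCc
    fun s hs => ⟨_, (hq s hs).2, h.hasDirDeriv _ (hq s hs).1 _⟩)

/-- The chain rule. -/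
theorem MBC1On.hasDirDeriv_comp {f : E → F} {U : Set E} (h : MBC1On f U) (hU : IsOpen U)
    {Z : Type*} [AddCommGroup Z] [Module ℝ Z] {c : Z → E} {z u : Z} {w : E}
    (hc : HasDirDeriv ℝ c z u w) (hz : c z ∈ U) :
    HasDirDeriv ℝ (fun y => f (c y)) z u (dirDeriv ℝ f (c z) w) := by
  -- Since `c (z + t • u)` is `c z` plus `t` times the difference quotient of `c`, that quotient
  -- serves as a direction varying with `t`; joint convergence allows this.
  have h1 : Tendsto (fun t : ℝ => ((c z, t⁻¹ • (c (z + t • u) - c z)), t)) (𝓝[≠] 0)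
      (𝓝 (c z, w) ×ˢ 𝓝[≠] (0 : ℝ)) := by
    refine Tendsto.prodMk ?_ tendsto_id
    exact tendsto_const_nhds.prodMk_nhds hc
  refine Tendsto.congr' ?_ ((h.tendsto_differenceQuotient hU hz w).comp h1)
  filter_upwards [self_mem_nhdsWithin] with t ht
  simp only [Function.comp_apply]
  rw [smul_inv_smul₀ ht, add_sub_cancel]

/-- The increment along `v + w` splits at `x + t • v`. The second piece is a quotient in the
direction `w` at a moving base point, which converges by joint convergence. -/
theorem MBC1On.dirDeriv_add [T2Space F] {f : E → F} {U : Set E} (h : MBC1On f U) (hU : IsOpen U)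
    {x : E} (hx : x ∈ U) (v w : E) :
    dirDeriv ℝ f x (v + w) = dirDeriv ℝ f x v + dirDeriv ℝ f x w := by
  have h1 : Tendsto (fun t : ℝ => ((x + t • v, w), t)) (𝓝[≠] 0)
      (𝓝 (x, w) ×ˢ 𝓝[≠] (0 : ℝ)) :=
    ((tendsto_add_smul_nhds x v).prodMk_nhds tendsto_const_nhds).prodMk tendsto_id
  have h2 := (h.hasDirDeriv x hx v).add ((h.tendsto_differenceQuotient hU hx w).comp h1)
  refine (h.hasDirDeriv x hx (v + w)).unique (Tendsto.congr (fun t => ?_) h2)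
  simp only [Function.comp_apply]
  rw [smul_add t v w, ← add_assoc]
  module

theorem MBC1On.isLinearMap_dirDeriv [T2Space F] {f : E → F} {U : Set E} (h : MBC1On f U)
    (hU : IsOpen U) {x : E} (hx : x ∈ U) : IsLinearMap ℝ (dirDeriv ℝ f x) :=
  ⟨h.dirDeriv_add hU hx, h.dirDeriv_smul hx⟩

/-- The expression is the quotient along `b` of `y ↦ t⁻¹ • (f (y + t • a) - f y)`, whose derivatives
along `b` are quotients along `a` of the derivative of `f` in the direction `b`. The mean value
theorem keeps it in any closed convex neighbourhood of the limit. As the second difference is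
symmetric in `a` and `b`, Schwarz's theorem follows. -/
theorem MBSmoothOn.tendsto_secondDifference {f : E → F} {U : Set E} (h : MBSmoothOn ℝ f U)
    (hU : IsOpen U) {x : E} (hx : x ∈ U) (a b : E) :
    Tendsto (fun t : ℝ => t⁻¹ • t⁻¹ • (f (x + t • b + t • a) - f (x + t • b) - f (x + t • a) + f x))
      (𝓝[≠] 0) (𝓝 (dirDeriv ℝ (fun y => dirDeriv ℝ f y b) x a)) := by
  refine tendsto_def.2 fun V hV => ?_
  obtain ⟨C, hC, hCc, hCx, hCV⟩ := exists_closed_convex_nhds_subset hV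
  have hq := ((h.mbC1On_dirDeriv b).tendsto_differenceQuotient hU hx a).eventually hC
  have hdom : ∀ᶠ q : (E × E) × ℝ in 𝓝 (x, a) ×ˢ 𝓝[≠] (0 : ℝ),
      q.1.1 ∈ U ∧ q.1.1 + q.2 • q.1.2 ∈ U := by
    have : ∀ᶠ q : E × E in 𝓝 (x, a), q.1 ∈ U :=
      continuous_fst.continuousAt.eventually (hU.mem_nhds hx)
    filter_upwards [eventually_forall_segment this] with q hq
    exact ⟨by simpa using hq 0 (by simp), hq q.2 le_rfl⟩
  -- Conditions on the base point and on the increment are separated, so that one `t` serves all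
  -- points of the segment along `b`.
  obtain ⟨pa, ha, pb, hb, hab⟩ := eventually_prod_iff.1 (hq.and hdom)
  have hseg : ∀ᶠ q : (E × E) × ℝ in 𝓝 (x, b) ×ˢ 𝓝[≠] (0 : ℝ),
      ∀ s : ℝ, |s| ≤ |q.2| → pa (q.1.1 + s • q.1.2, a) := by
    have : ∀ᶠ q : E × E in 𝓝 (x, b), pa (q.1, a) := by
      have hc : Tendsto (fun q : E × E => (q.1, a)) (𝓝 (x, b)) (𝓝 (x, a)) :=
        Continuous.tendsto (f := fun q : E × E => (q.1, a)) (by fun_prop) (x, b)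
      exact hc.eventually ha
    exact eventually_forall_segment this
  have hline : Tendsto (fun t : ℝ => ((x, b), t)) (𝓝[≠] 0) (𝓝 (x, b) ×ˢ 𝓝[≠] (0 : ℝ)) :=
    tendsto_const_nhds.prodMk tendsto_id
  filter_upwards [hline.eventually hseg, hb, self_mem_nhdsWithin] with t ht htb ht0
  have hmem := differenceQuotient_mem_of_hasDirDeriv (f := fun y => t⁻¹ • (f (y + t • a) - f y))
    (x := x) (v := b) (t := t) ht0 hCx hCc (fun s hs => by
      obtain ⟨hsC, hsU, hsU'⟩ := hab (ht s hs) htb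
      refine ⟨_, hsC, ?_⟩
      have h1 : HasDirDeriv ℝ (fun y => f (y + t • a)) (x + s • b) b
          (dirDeriv ℝ f (x + s • b + t • a) b) :=
        (h.mbC1On.hasDirDeriv _ hsU' b).comp_line (g := fun y => y + t • a) fun r => by
            dsimp only
            abel
      have h2 := (h1.sub (h.mbC1On.hasDirDeriv _ hsU b)).const_smul t⁻¹
      refine Tendsto.congr (fun r => ?_) h2
      module)
  refine hCV ?_
  simp only
  convert hmem using 2
  module

/-- Schwarz's theorem on the symmetry of second derivatives. -/
theorem MBSmoothOn.dirDeriv_comm [T2Space F] {f : E → F} {U : Set E} (h : MBSmoothOn ℝ f U)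
    (hU : IsOpen U) {x : E} (hx : x ∈ U) (a b : E) :
    dirDeriv ℝ (fun y => dirDeriv ℝ f y b) x a = dirDeriv ℝ (fun y => dirDeriv ℝ f y a) x b := by
  refine tendsto_nhds_unique (h.tendsto_secondDifference hU hx a b)
    (Tendsto.congr (fun t => ?_) (h.tendsto_secondDifference hU hx b a))
  rw [add_right_comm x (t • a)]
  congr 2
  abel

/-- The derivative of `t ↦ df (x + t u; l (x + t u))`. -/
theorem MBSmoothOn.hasDirDeriv_dirDeriv_apply [T2Space F] {f : E → F} {U : Set E}
    (h : MBSmoothOn ℝ f U) (hU : IsOpen U) {x : E} (hx : x ∈ U) {l : E → E} {u l' : E}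
    (hl : HasDirDeriv ℝ l x u l') :
    HasDirDeriv ℝ (fun y => dirDeriv ℝ f y (l y)) x u
      (dirDeriv ℝ (fun y => dirDeriv ℝ f y (l x)) x u + dirDeriv ℝ f x l') := by
  have hopen : U ×ˢ (univ : Set E) ∈ 𝓝 (x, l') :=
    (hU.prod isOpen_univ).mem_nhds ⟨hx, mem_univ _⟩
  have h1 : Tendsto (fun p : E × E => dirDeriv ℝ f p.1 p.2) (𝓝 (x, l'))
      (𝓝 (dirDeriv ℝ f x l')) := h.mbC1On.continuousOn.continuousAt hopen
  have hl' : Tendsto (fun t : ℝ => t⁻¹ • (l (x + t • u) - l x)) (𝓝[≠] 0) (𝓝 l') := hl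
  have h0 : Tendsto (fun t : ℝ => (x + t • u, t⁻¹ • (l (x + t • u) - l x))) (𝓝[≠] 0) (𝓝 (x, l')) :=
    (tendsto_add_smul_nhds x u).prodMk_nhds hl'
  have h2 : Tendsto (fun t : ℝ => dirDeriv ℝ f (x + t • u) (t⁻¹ • (l (x + t • u) - l x)))
      (𝓝[≠] 0) (𝓝 (dirDeriv ℝ f x l')) := by
    have h2 := h1.comp h0
    simp only [Function.comp_def] at h2
    exact h2
  have h3 := ((h.mbC1On_dirDeriv (l x)).hasDirDeriv x hx u)
  -- The base point is varied first with the direction frozen at `l x`; the rest is the derivative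
  -- at `x + t • u` applied to the increment of `l`, by linearity.
  refine Tendsto.congr' ?_ (Tendsto.add h3 h2)
  filter_upwards [(tendsto_add_smul_nhds x u).eventually (hU.mem_nhds hx)] with t ht
  have hlin := h.mbC1On.isLinearMap_dirDeriv hU ht
  rw [hlin.map_smul, hlin.map_sub, ← smul_add]
  congr 1
  abel

end DirectionalCalculus

/-! ### Closed 2-forms in a chart and the cocycle identity. -/

section TrilinearForms

variable {E : Type*} [AddCommGroup E] [Module ℝ E]

theorem IsLinearMap.hasDirDeriv {F : Type*} [AddCommGroup F] [Module ℝ F] [TopologicalSpace F]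
    {f : E → F} (hf : IsLinearMap ℝ f) (x v : E) : HasDirDeriv ℝ f x v (f v) := by
  refine Tendsto.congr' ?_ tendsto_const_nhds
  filter_upwards [self_mem_nhdsWithin] with t ht
  rw [hf.map_add, hf.map_smul, add_sub_cancel_left, inv_smul_smul₀ ht]

variable [TopologicalSpace E] [IsTopologicalAddGroup E] [ContinuousSMul ℝ E]

/-- The product rule for a smooth family of bilinear forms, evaluated along curves. -/
theorem hasDirDeriv_bilinearForm_apply {B : E → E → E → ℝ} {V : Set E} (hV : IsOpen V)
    (hB : MBC1On (fun p : E × E × E => B p.1 p.2.1 p.2.2) (V ×ˢ univ))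
    (hl : ∀ y ∈ V, ∀ v, IsLinearMap ℝ (fun u => B y u v))
    (hr : ∀ y ∈ V, ∀ u, IsLinearMap ℝ (B y u))
    {Z : Type*} [AddCommGroup Z] [Module ℝ Z] {y u v : Z → E} {z a : Z} {y' u' v' : E}
    (hy : HasDirDeriv ℝ y z a y') (hu : HasDirDeriv ℝ u z a u') (hv : HasDirDeriv ℝ v z a v')
    (hz : y z ∈ V) :
    HasDirDeriv ℝ (fun x => B (y x) (u x) (v x)) z a
      (dirDeriv ℝ (fun x => B x (u z) (v z)) (y z) y' + B (y z) u' (v z) + B (y z) (u z) v') := by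
  have hopen : IsOpen (V ×ˢ (univ : Set (E × E))) := hV.prod isOpen_univ
  have hmem : (y z, u z, v z) ∈ V ×ˢ (univ : Set (E × E)) := ⟨hz, mem_univ _⟩
  have hc : HasDirDeriv ℝ (fun x => (y x, u x, v x)) z a (y', u', v') := by
    have h := hy.prodMk_nhds (hu.prodMk_nhds hv)
    exact h
  have h := hB.hasDirDeriv_comp hopen hc hmem
  -- The total derivative is the sum of three partial ones; the two in the linear slots are the form
  -- itself.
  have h1 := (hB.hasDirDeriv _ hmem (y', 0, 0)).comp_line (g := fun x : E => (x, u z, v z))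
    (x' := y z) (v' := y') (fun t => by simp)
  have h2 := (hB.hasDirDeriv _ hmem (0, u', 0)).comp_line (g := fun x : E => (y z, x, v z))
    (x' := u z) (v' := u') (fun t => by simp)
  have h3 := (hB.hasDirDeriv _ hmem (0, 0, v')).comp_line (g := fun x : E => (y z, u z, x))
    (x' := v z) (v' := v') (fun t => by simp)
  have hsum : ((y', u', v') : E × E × E) = (y', 0, 0) + (0, u', 0) + (0, 0, v') := by simp
  rw [hsum, hB.dirDeriv_add hopen hmem, hB.dirDeriv_add hopen hmem] at h
  rw [h1.dirDeriv_eq, ← h2.unique ((hl _ hz _).hasDirDeriv _ _),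
    ← h3.unique ((hr _ hz _).hasDirDeriv _ _)]
  exact h

variable [LocallyConvexSpace ℝ E] [T2Space E]
  {𝔤 : Type*} [AddCommGroup 𝔤] [Module ℝ 𝔤] [TopologicalSpace 𝔤] [IsTopologicalAddGroup 𝔤]
  [ContinuousSMul ℝ 𝔤]

/-- A closed form whose pullback is constant on a frame of vector fields satisfies the cocycle
identity for the bracket of these vector fields. -/
theorem cocycle_of_pullback_const {F : 𝔤 → E} {U : Set 𝔤} (hU : IsOpen U) (hF : MBSmoothOn ℝ F U)
    {B : E → E → E → ℝ} {V : Set E} (hV : IsOpen V) (hFV : MapsTo F U V)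
    (hB : MBC1On (fun p : E × E × E => B p.1 p.2.1 p.2.2) (V ×ˢ univ))
    (hl : ∀ y ∈ V, ∀ v, IsLinearMap ℝ (fun u => B y u v))
    (hr : ∀ y ∈ V, ∀ u, IsLinearMap ℝ (B y u))
    (halt : ∀ y ∈ V, ∀ u v, B y u v = -B y v u)
    (hclosed : ∀ y ∈ V, ∀ u v w, dirDeriv ℝ (fun y => B y v w) y u
      + dirDeriv ℝ (fun y => B y w u) y v + dirDeriv ℝ (fun y => B y u v) y w = 0)
    {x₀ : 𝔤} (hx₀ : x₀ ∈ U) {L L' : 𝔤 → 𝔤 → 𝔤} (hL₀ : ∀ ξ, L ξ x₀ = ξ)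
    (hL : ∀ ξ ζ, HasDirDeriv ℝ (L ξ) x₀ ζ (L' ξ ζ)) {c : 𝔤 → 𝔤 → ℝ}
    (hc : ∀ ξ η, ∀ x ∈ U, B (F x) (dirDeriv ℝ F x (L ξ x)) (dirDeriv ℝ F x (L η x)) = c ξ η)
    (ξ η ζ : 𝔤) :
    c (L' η ξ - L' ξ η) ζ + c (L' ζ η - L' η ζ) ξ + c (L' ξ ζ - L' ζ ξ) η = 0 := by
  have hc₀ : ∀ ξ η, c ξ η = B (F x₀) (dirDeriv ℝ F x₀ ξ) (dirDeriv ℝ F x₀ η) := fun ξ η => by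
    rw [← hc ξ η x₀ hx₀, hL₀, hL₀]
  have hy₀ : F x₀ ∈ V := hFV hx₀
  have hdF := hF.mbC1On.isLinearMap_dirDeriv hU hx₀
  have key : ∀ ξ η ζ : 𝔤,
      dirDeriv ℝ (fun y => B y (dirDeriv ℝ F x₀ ξ) (dirDeriv ℝ F x₀ η)) (F x₀) (dirDeriv ℝ F x₀ ζ)
        + (B (F x₀) (dirDeriv ℝ (fun y => dirDeriv ℝ F y ξ) x₀ ζ) (dirDeriv ℝ F x₀ η)
          + B (F x₀) (dirDeriv ℝ F x₀ (L' ξ ζ)) (dirDeriv ℝ F x₀ η))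
        + (B (F x₀) (dirDeriv ℝ F x₀ ξ) (dirDeriv ℝ (fun y => dirDeriv ℝ F y η) x₀ ζ)
          + B (F x₀) (dirDeriv ℝ F x₀ ξ) (dirDeriv ℝ F x₀ (L' η ζ))) = 0 := by
    intro ξ η ζ
    have h := hasDirDeriv_bilinearForm_apply hV hB hl hr (hF.mbC1On.hasDirDeriv x₀ hx₀ ζ)
      (hF.hasDirDeriv_dirDeriv_apply hU hx₀ (hL ξ ζ))
      (hF.hasDirDeriv_dirDeriv_apply hU hx₀ (hL η ζ)) hy₀
    rw [(hl _ hy₀ _).map_add, (hr _ hy₀ _).map_add] at h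
    simp only [hL₀] at h
    refine h.unique ((hasDirDeriv_const (c ξ η) x₀ ζ).congr_of_eventuallyEq ?_ ?_)
    · filter_upwards [(tendsto_add_smul_nhds x₀ ζ).eventually (hU.mem_nhds hx₀)] with t ht
      exact (hc ξ η _ ht).symm
    · exact (hc ξ η _ hx₀).symm
  have k1 := key ξ η ζ
  have k2 := key η ζ ξ
  have k3 := key ζ ξ η
  have hcl := hclosed _ hy₀ (dirDeriv ℝ F x₀ ξ) (dirDeriv ℝ F x₀ η) (dirDeriv ℝ F x₀ ζ)
  -- Schwarz is applied so that each mixed second derivative occurs twice in the same form; after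
  -- antisymmetry the pairs cancel in the sum.
  rw [hF.dirDeriv_comm hU hx₀ ζ ξ, hF.dirDeriv_comm hU hx₀ ζ η] at k1
  rw [hF.dirDeriv_comm hU hx₀ ξ η] at k2
  rw [halt _ hy₀ (dirDeriv ℝ F x₀ _) (dirDeriv ℝ (fun y => dirDeriv ℝ F y _) _ _),
    halt _ hy₀ (dirDeriv ℝ F x₀ _) (dirDeriv ℝ F x₀ (L' _ _))] at k1 k2 k3
  simp only [hc₀, hdF.map_sub, (hl _ hy₀ _).map_sub]
  linarith

end TrilinearForms

/-! ### Orbit maps in charts. -/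

section Orbits

variable {E 𝔤 G M : Type*} [TopologicalSpace E] [TopologicalSpace M] [ChartedSpace E M]
  [TopologicalSpace 𝔤] [TopologicalSpace G] [ChartedSpace 𝔤 G] [Group G] [MulAction G M]

variable (E 𝔤 G) in
/-- The orbit map of `m` in the preferred charts at `1` and `m`. -/
noncomputable def orbitMapInChart (m : M) (x : 𝔤) : E :=
  chartAt E m ((chartAt 𝔤 (1 : G)).symm x • m)

variable (E 𝔤 G) in
/-- The domain of the orbit map of `m` in the preferred charts at `1` and `m`. -/
def orbitMapDomain (m : M) : Set 𝔤 :=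
  (chartAt 𝔤 (1 : G)).target ∩
    (chartAt 𝔤 (1 : G)).symm ⁻¹' ((fun g : G => g • m) ⁻¹' (chartAt E m).source)

theorem chartAt_one_mem_orbitMapDomain (m : M) :
    chartAt 𝔤 (1 : G) 1 ∈ orbitMapDomain E 𝔤 G m := by
  refine ⟨mem_chart_target 𝔤 (1 : G), ?_⟩
  rw [mem_preimage, (chartAt 𝔤 (1 : G)).left_inv (mem_chart_source 𝔤 (1 : G)), mem_preimage,
    one_smul]
  exact mem_chart_source E m

theorem orbitMapInChart_chartAt_one (m : M) :
    orbitMapInChart E 𝔤 G m (chartAt 𝔤 (1 : G) 1) = chartAt E m m := by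
  rw [orbitMapInChart, (chartAt 𝔤 (1 : G)).left_inv (mem_chart_source 𝔤 (1 : G)), one_smul]

end Orbits

/-! ### Left invariant fields, equivariance and the cocycle. -/

section Manifolds

variable {E : Type*} [AddCommGroup E] [Module ℝ E] [TopologicalSpace E]
  {M : Type*} [TopologicalSpace M] [ChartedSpace E M]
  {𝔤 : Type*} [AddCommGroup 𝔤] [Module ℝ 𝔤] [TopologicalSpace 𝔤]
  {G : Type*} [TopologicalSpace G] [ChartedSpace 𝔤 G] [Group G]

theorem formInChart_of_symm_eq {R : Type*} (B : (m : M) → LCTangent E m → LCTangent E m → R)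
    {e : OpenPartialHomeomorph M E} {x : E} {p : M} (hp : e.symm x = p) (u v : E) :
    formInChart B e x u v = B p (dirDeriv ℝ (fun y => chartAt E p (e.symm y)) x u)
      (dirDeriv ℝ (fun y => chartAt E p (e.symm y)) x v) := by
  subst hp
  rfl

theorem IsLCLieGroup.continuous_mul_left (hG : IsLCLieGroup 𝔤 G) (g : G) :
    Continuous (fun h : G => g * h) :=
  hG.continuous_mul.comp (f := fun h : G => (g, h)) (by fun_prop)

/-- Left translation is the slice of multiplication whose first coordinate is frozen at that of `g`.
-/
theorem IsLCLieGroup.hasDirDeriv_mul_left (hG : IsLCLieGroup 𝔤 G)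
    {e e' : OpenPartialHomeomorph G 𝔤} (he : e ∈ atlas 𝔤 G) (he' : e' ∈ atlas 𝔤 G) (g : G) {y : 𝔤}
    (hy : y ∈ e.target) (hgy : g * e.symm y ∈ e'.source) (ξ : 𝔤) :
    HasDirDeriv ℝ (fun z => e' (g * e.symm z)) y ξ
      (dirDeriv ℝ (fun z => e' (g * e.symm z)) y ξ) := by
  have hg := (chartAt 𝔤 g).left_inv (mem_chart_source 𝔤 g)
  have h := ((hG.smooth_mul _ (chart_mem_atlas 𝔤 g) e he e' he').mbC1On.hasDirDeriv
    (chartAt 𝔤 g g, y) ⟨mem_chart_target 𝔤 g, hy, by rwa [hg]⟩ (0, ξ)).comp_line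
      (g := fun z => (chartAt 𝔤 g g, z)) (x' := y) (v' := ξ) (fun t => by simp)
  simp only [hg] at h
  exact hasDirDeriv_dirDeriv ⟨_, h⟩

variable [MulAction G M] {Ω : (m : M) → LCTangent E m →ₗ[ℝ] LCTangent E m →ₗ[ℝ] ℝ}

theorem IsSymplecticAction.isOpen_orbitMapDomain (hact : IsSymplecticAction 𝔤 G Ω) (m : M) :
    IsOpen (orbitMapDomain E 𝔤 G m) :=
  (chartAt 𝔤 (1 : G)).isOpen_inter_preimage_symm
    ((chartAt E m).open_source.preimage (hact.smooth_orbitMap m).1)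

theorem IsSymplecticAction.mbSmoothOn_orbitMapInChart (hact : IsSymplecticAction 𝔤 G Ω) (m : M) :
    MBSmoothOn ℝ (orbitMapInChart E 𝔤 G m) (orbitMapDomain E 𝔤 G m) :=
  (hact.smooth_orbitMap m).2 _ (chart_mem_atlas 𝔤 1) _ (chart_mem_atlas E m)

variable [IsTopologicalAddGroup E] [ContinuousSMul ℝ E] [IsTopologicalAddGroup 𝔤]
  [ContinuousSMul ℝ 𝔤]

/-- Near the identity, a property of `g * h` holds along lines in the preferred chart. -/
theorem IsLCLieGroup.eventually_mul_left (hG : IsLCLieGroup 𝔤 G) (g : G) {p : G → Prop}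
    (hp : ∀ᶠ h in 𝓝 g, p h) (ξ : 𝔤) :
    ∀ᶠ t : ℝ in 𝓝[≠] 0, p (g * (chartAt 𝔤 (1 : G)).symm (chartAt 𝔤 (1 : G) 1 + t • ξ)) := by
  have h1 := (chartAt 𝔤 (1 : G)).continuousAt_symm (mem_chart_target 𝔤 (1 : G))
  have h2 := (hG.continuous_mul_left g).continuousAt.comp h1
  have h3 := h2.tendsto.comp (tendsto_add_smul_nhds _ ξ)
  simp only [Function.comp_apply, (chartAt 𝔤 (1 : G)).left_inv (mem_chart_source 𝔤 (1 : G)),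
    mul_one] at h3
  exact h3.eventually hp

variable [T2Space E]

theorem tangentOfCoord_chartAt (m : M) (u : E) :
    dirDeriv ℝ (fun y => chartAt E m ((chartAt E m).symm y)) (chartAt E m m) u = u := by
  have hm := mem_chart_target E m
  refine ((hasDirDeriv_id _ u).congr_of_eventuallyEq ?_ ?_).dirDeriv_eq
  · filter_upwards [(tendsto_add_smul_nhds _ u).eventually
      ((chartAt E m).open_target.mem_nhds hm)] with t ht
    exact ((chartAt E m).right_inv ht).symm
  · exact ((chartAt E m).right_inv hm).symm

theorem formInChart_chartAt {R : Type*} (B : (m : M) → LCTangent E m → LCTangent E m → R)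
    (m : M) (u v : E) : formInChart B (chartAt E m) (chartAt E m m) u v = B m u v := by
  rw [formInChart_of_symm_eq B ((chartAt E m).left_inv (mem_chart_source E m)),
    tangentOfCoord_chartAt, tangentOfCoord_chartAt]

theorem leftInvariantField_one [T2Space 𝔤] (ξ : 𝔤) : leftInvariantField G ξ (1 : G) = ξ := by
  have h := tangentOfCoord_chartAt (E := 𝔤) (1 : G) ξ
  simpa only [leftInvariantField, lcTangentMap, one_mul] using h

theorem lieAlgBracket_eq [T2Space 𝔤] (ξ η : 𝔤) :
    lieAlgBracket (𝔤 := 𝔤) G ξ η =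
      dirDeriv ℝ (fieldInChart ℝ (chartAt 𝔤 (1 : G)) (leftInvariantField G η))
        (chartAt 𝔤 (1 : G) 1) ξ
      - dirDeriv ℝ (fieldInChart ℝ (chartAt 𝔤 (1 : G)) (leftInvariantField G ξ))
        (chartAt 𝔤 (1 : G) 1) η := by
  rw [lieAlgBracket, fieldBracket, leftInvariantField_one, leftInvariantField_one]

theorem continuous_form_of_mbSmoothOn {R : Type*} [AddCommGroup R] [Module ℝ R]
    [TopologicalSpace R] (B : (m : M) → LCTangent E m → LCTangent E m → R)
    (m : M) (hB : MBSmoothOn ℝ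
      (fun p : E × E × E => formInChart B (chartAt E m) p.1 p.2.1 p.2.2)
      ((chartAt E m).target ×ˢ univ)) :
    Continuous (fun p : E × E => B m p.1 p.2) := by
  have h := hB.continuousOn.comp_continuous (f := fun p : E × E => (chartAt E m m, p.1, p.2))
    (by fun_prop) fun _ => ⟨mem_chart_target E m, mem_univ _⟩
  simpa only [Function.comp_def, formInChart_chartAt] using h

variable [LocallyConvexSpace ℝ E] [LocallyConvexSpace ℝ 𝔤]

theorem IsLCManifold.isLinearMap_tangentOfCoord (hM : IsLCManifold ℝ E M)
    {e : OpenPartialHomeomorph M E} (he : e ∈ atlas E M) {x : E} (hx : x ∈ e.target) :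
    IsLinearMap ℝ (fun u : E => (tangentOfCoord ℝ e x u : E)) :=
  (hM.smooth_transition e he _ (chart_mem_atlas E (e.symm x))).mbC1On.isLinearMap_dirDeriv
    (e.isOpen_inter_preimage_symm (chartAt E (e.symm x)).open_source)
    ⟨hx, mem_chart_source E _⟩

/-- The field at `g` is defined through the preferred chart at `g`, which varies with `g`. The chain
rule for the chart change removes it, leaving a partial derivative of multiplication in one fixed
chart. -/
theorem hasDirDeriv_fieldInChart_leftInvariantField (hG : IsLCLieGroup 𝔤 G) (ξ : 𝔤) {x : 𝔤}
    (hx : x ∈ (chartAt 𝔤 (1 : G)).target) :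
    HasDirDeriv ℝ (fun y => chartAt 𝔤 (1 : G)
        ((chartAt 𝔤 (1 : G)).symm x * (chartAt 𝔤 (1 : G)).symm y)) (chartAt 𝔤 (1 : G) 1) ξ
      (fieldInChart ℝ (chartAt 𝔤 (1 : G)) (leftInvariantField G ξ) x) := by
  set φ := chartAt 𝔤 (1 : G) with hφ
  have hφ1 : φ.symm (φ 1) = 1 := φ.left_inv (mem_chart_source 𝔤 (1 : G))
  set g := φ.symm x with hg
  have hgφ : g ∈ φ.source := φ.map_target hx
  set κ := chartAt 𝔤 g with hκ
  have h1 : HasDirDeriv ℝ (fun y => κ (g * φ.symm y)) (φ 1) ξ (leftInvariantField G ξ g) :=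
    hG.hasDirDeriv_mul_left (chart_mem_atlas 𝔤 1) (chart_mem_atlas 𝔤 g) g
      (mem_chart_target 𝔤 (1 : G)) (by rw [hφ1, mul_one]; exact mem_chart_source 𝔤 g) ξ
  have hbase : κ (g * φ.symm (φ 1)) = κ g := by rw [hφ1, mul_one]
  have h2 := (hG.manifold.smooth_transition κ (chart_mem_atlas 𝔤 g) φ
    (chart_mem_atlas 𝔤 1)).mbC1On.hasDirDeriv_comp
      (κ.isOpen_inter_preimage_symm φ.open_source) h1
      (by
        rw [hbase]
        refine ⟨mem_chart_target 𝔤 g, ?_⟩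
        rwa [mem_preimage, κ.left_inv (mem_chart_source 𝔤 g)])
  rw [hbase] at h2
  refine h2.congr_of_eventuallyEq ?_ ?_
  · filter_upwards [hG.eventually_mul_left g (κ.open_source.mem_nhds (mem_chart_source 𝔤 g)) ξ]
      with t ht
    exact congrArg φ (κ.left_inv ht)
  · rw [hbase, κ.left_inv (mem_chart_source 𝔤 g), hφ1, mul_one]

/-- Equivariance of the orbit map: it maps the left invariant vector field `ξ` at `g` to the image
of the fundamental vector field under the action of `g`. -/
theorem IsSymplecticAction.lcTangentMap_fundamentalField (hG : IsLCLieGroup 𝔤 G)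
    (hM : IsLCManifold ℝ E M) (hact : IsSymplecticAction 𝔤 G Ω) (m : M) (ξ : 𝔤) {x : 𝔤}
    (hx : x ∈ orbitMapDomain E 𝔤 G m) :
    lcTangentMap (E := E) (F := E) (p := m) ℝ
        (fun m' : M => (chartAt 𝔤 (1 : G)).symm x • m') rfl (fundamentalField (G := G) ξ m) =
      dirDeriv ℝ (fun y => chartAt E ((chartAt 𝔤 (1 : G)).symm x • m) ((chartAt E m).symm y))
        (orbitMapInChart E 𝔤 G m x)
        (dirDeriv ℝ (orbitMapInChart E 𝔤 G m) x
          (fieldInChart ℝ (chartAt 𝔤 (1 : G)) (leftInvariantField G ξ) x)) := by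
  have hcurve := hasDirDeriv_fieldInChart_leftInvariantField hG ξ hx.1
  have hF := (hact.mbSmoothOn_orbitMapInChart m).mbC1On
  have hU := hact.isOpen_orbitMapDomain m
  have hx₀ : chartAt 𝔤 (1 : G) 1 ∈ orbitMapDomain E 𝔤 G m := chartAt_one_mem_orbitMapDomain m
  have hFx₀ := orbitMapInChart_chartAt_one (E := E) (𝔤 := 𝔤) (G := G) m
  have horbit := (hact.smooth_orbitMap m).1
  have hev := fun g p => hG.eventually_mul_left g (p := p)
  obtain ⟨hxt, hxs⟩ := hx
  have hxs' : (chartAt 𝔤 (1 : G)).symm x • m ∈ (chartAt E m).source := hxs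
  set φ := chartAt 𝔤 (1 : G) with hφ
  set ψ := chartAt E m with hψ
  have hφ1 : φ.symm (φ 1) = 1 := φ.left_inv (mem_chart_source 𝔤 (1 : G))
  set g := φ.symm x with hg
  set K := chartAt E (g • m) with hK
  have hm : ψ.symm (ψ m) = m := ψ.left_inv (mem_chart_source E m)
  have h1 := ((hact.smooth_smul g).2 ψ (chart_mem_atlas E m) K
    (chart_mem_atlas E _)).mbC1On.hasDirDeriv_comp
      (ψ.isOpen_inter_preimage_symm (K.open_source.preimage (hact.smooth_smul g).1))
      (hF.hasDirDeriv _ hx₀ ξ) (by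
        rw [hFx₀]
        refine ⟨mem_chart_target E m, ?_⟩
        rw [mem_preimage, mem_preimage, hm]
        exact mem_chart_source E _)
  rw [hFx₀] at h1
  have hcx : φ (g * φ.symm (φ 1)) = x := by rw [hφ1, mul_one, hg, φ.right_inv hxt]
  have hFx : ψ.symm (orbitMapInChart E 𝔤 G m x) = g • m := ψ.left_inv hxs'
  have h2 := hF.hasDirDeriv_comp hU hcurve (by rw [hcx]; exact ⟨hxt, hxs⟩)
  have h3 := (hM.smooth_transition ψ (chart_mem_atlas E m) K
    (chart_mem_atlas E _)).mbC1On.hasDirDeriv_comp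
      (ψ.isOpen_inter_preimage_symm K.open_source) h2 (by
        rw [hcx]
        refine ⟨ψ.map_source hxs', ?_⟩
        rw [mem_preimage, hFx]
        exact mem_chart_source E _)
  rw [hcx] at h3
  -- Both are derivatives at the identity of the two sides of `g • (h • m) = (g * h) • m`, read in
  -- the chart `K`.
  refine h1.unique (h3.congr_of_eventuallyEq ?_ ?_)
  · have e1 := hev g _ (φ.open_source.mem_nhds (φ.map_target hxt)) ξ
    have e2 := hev g _ (horbit.continuousAt.eventually (ψ.open_source.mem_nhds hxs')) ξ
    have e3 := hev 1 _ (horbit.continuousAt.eventually (ψ.open_source.mem_nhds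
      (by
        change (1 : G) • m ∈ _
        rw [one_smul]
        exact mem_chart_source E m))) ξ
    filter_upwards [e1, e2, e3] with t h1 h2 h3
    rw [one_mul] at h3
    simp only [orbitMapInChart, ← hφ, ← hψ]
    rw [φ.left_inv h1, ψ.left_inv h2, ψ.left_inv h3, mul_smul]
  · dsimp only
    rw [hcx, hFx, hFx₀, hm]

/-- The pullback of the symplectic form under an orbit map is left invariant. -/
theorem formInChart_orbitMapInChart (hG : IsLCLieGroup 𝔤 G)
    (hM : IsLCManifold ℝ E M) (hact : IsSymplecticAction 𝔤 G Ω) (m : M) (ξ η : 𝔤) {x : 𝔤}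
    (hx : x ∈ orbitMapDomain E 𝔤 G m) :
    formInChart (fun m u v => Ω m u v) (chartAt E m) (orbitMapInChart E 𝔤 G m x)
      (dirDeriv ℝ (orbitMapInChart E 𝔤 G m) x
        (fieldInChart ℝ (chartAt 𝔤 (1 : G)) (leftInvariantField G ξ) x))
      (dirDeriv ℝ (orbitMapInChart E 𝔤 G m) x
        (fieldInChart ℝ (chartAt 𝔤 (1 : G)) (leftInvariantField G η) x)) =
      kostantSouriau G Ω m ξ η := by
  have hp : (chartAt E m).symm (orbitMapInChart E 𝔤 G m x) = (chartAt 𝔤 (1 : G)).symm x • m :=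
    (chartAt E m).left_inv hx.2
  rw [formInChart_of_symm_eq _ hp,
    ← hact.lcTangentMap_fundamentalField hG hM m ξ hx,
    ← hact.lcTangentMap_fundamentalField hG hM m η hx]
  exact hact.preserves _ m _ _

variable [T2Space 𝔤]

/-- Left invariant vector fields are differentiable at the identity. -/
theorem hasDirDeriv_dirDeriv_fieldInChart (hG : IsLCLieGroup 𝔤 G) (ξ ζ : 𝔤) :
    HasDirDeriv ℝ (fieldInChart ℝ (chartAt 𝔤 (1 : G)) (leftInvariantField G ξ))
      (chartAt 𝔤 (1 : G) 1) ζ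
      (dirDeriv ℝ (fieldInChart ℝ (chartAt 𝔤 (1 : G)) (leftInvariantField G ξ))
        (chartAt 𝔤 (1 : G) 1) ζ) := by
  have hfield := fun x => hasDirDeriv_fieldInChart_leftInvariantField hG ξ (x := x)
  set φ := chartAt 𝔤 (1 : G) with hφ
  have hφa : φ ∈ atlas 𝔤 G := chart_mem_atlas 𝔤 1
  have hφt : φ 1 ∈ φ.target := mem_chart_target 𝔤 (1 : G)
  have hφ1 : φ.symm (φ 1) = 1 := φ.left_inv (mem_chart_source 𝔤 (1 : G))
  have hmul := hG.smooth_mul φ hφa φ hφa φ hφa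
  have hdom : ∀ x ∈ φ.target, (x, φ 1) ∈ {p : 𝔤 × 𝔤 | p.1 ∈ φ.target ∧ p.2 ∈ φ.target ∧
      φ.symm p.1 * φ.symm p.2 ∈ φ.source} := fun x hx =>
    ⟨hx, hφt, by rw [hφ1, mul_one]; exact φ.map_target hx⟩
  -- In the chart the field is the partial derivative of multiplication in its second argument at
  -- the identity, so second order smoothness of multiplication makes it differentiable.
  have heq : ∀ x ∈ φ.target,
      dirDeriv ℝ (fun p : 𝔤 × 𝔤 => φ (φ.symm p.1 * φ.symm p.2)) (x, φ 1) (0, ξ) =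
        fieldInChart ℝ φ (leftInvariantField G ξ) x := fun x hx =>
    ((hmul.mbC1On.hasDirDeriv (x, φ 1) (hdom x hx) (0, ξ)).comp_line (g := fun z => (x, z))
      (x' := φ 1) (v' := ξ) (fun t => by simp)).unique (hfield x hx)
  have h := ((hmul.mbC1On_dirDeriv (0, ξ)).hasDirDeriv (φ 1, φ 1) (hdom _ hφt) (ζ, 0)).comp_line
    (g := fun z => (z, φ 1)) (x' := φ 1) (v' := ζ) (fun t => by simp)
  refine hasDirDeriv_dirDeriv ⟨_, h.congr_of_eventuallyEq ?_ (heq _ hφt)⟩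
  filter_upwards [(tendsto_add_smul_nhds _ ζ).eventually (φ.open_target.mem_nhds hφt)] with t ht
  exact heq _ ht

theorem fieldInChart_leftInvariantField_one (hG : IsLCLieGroup 𝔤 G) (ξ : 𝔤) :
    fieldInChart ℝ (chartAt 𝔤 (1 : G)) (leftInvariantField G ξ) (chartAt 𝔤 (1 : G) 1) = ξ := by
  have h := hasDirDeriv_fieldInChart_leftInvariantField hG ξ (mem_chart_target 𝔤 (1 : G))
  simp only [(chartAt 𝔤 (1 : G)).left_inv (mem_chart_source 𝔤 (1 : G)), one_mul] at h
  rw [← h.dirDeriv_eq, tangentOfCoord_chartAt]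

theorem isContinuousTwoCocycle_kostantSouriau (hG : IsLCLieGroup 𝔤 G)
    (hM : IsLCManifold ℝ E M) (hΩ : IsSymplecticForm Ω) (hact : IsSymplecticAction 𝔤 G Ω) (m : M) :
    IsContinuousTwoCocycle (lieAlgBracket (𝔤 := 𝔤) G) (kostantSouriau (𝔤 := 𝔤) G Ω m) := by
  have hF := hact.mbSmoothOn_orbitMapInChart m
  have hU := hact.isOpen_orbitMapDomain m
  have hx₀ : chartAt 𝔤 (1 : G) 1 ∈ orbitMapDomain E 𝔤 G m := chartAt_one_mem_orbitMapDomain m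
  have hX : IsLinearMap ℝ (fun ξ : 𝔤 => (fundamentalField (G := G) ξ m : E)) :=
    hF.mbC1On.isLinearMap_dirDeriv hU hx₀
  have hXc : Continuous (fun ξ : 𝔤 => (fundamentalField (G := G) ξ m : E)) :=
    hF.mbC1On.continuous_dirDeriv hx₀
  have hψ := chart_mem_atlas E m
  refine ⟨fun η => ⟨fun a b => ?_, fun c a => ?_⟩, fun ξ => ⟨fun a b => ?_, fun c a => ?_⟩,
    fun ξ => hΩ.alternating m _, ?_, ?_⟩
  · simp only [kostantSouriau, hX.map_add, map_add, LinearMap.add_apply]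
  · simp only [kostantSouriau, hX.map_smul, map_smul, LinearMap.smul_apply]
  · simp only [kostantSouriau, hX.map_add, map_add]
  · simp only [kostantSouriau, hX.map_smul, map_smul]
  · exact (continuous_form_of_mbSmoothOn _ m (hΩ.smooth _ hψ)).comp
      ((hXc.comp continuous_fst).prodMk (hXc.comp continuous_snd))
  · intro ξ η ζ
    simp only [lieAlgBracket_eq]
    have hT := fun y (hy : y ∈ (chartAt E m).target) => hM.isLinearMap_tangentOfCoord hψ hy
    refine cocycle_of_pullback_const (B := formInChart (fun m u v => Ω m u v) (chartAt E m))
      (V := (chartAt E m).target)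
      (L := fun ξ => fieldInChart ℝ (chartAt 𝔤 (1 : G)) (leftInvariantField G ξ))
      (L' := fun ξ ζ => dirDeriv ℝ (fieldInChart ℝ (chartAt 𝔤 (1 : G)) (leftInvariantField G ξ))
        (chartAt 𝔤 (1 : G) 1) ζ)
      hU hF (chartAt E m).open_target (fun x hx => (chartAt E m).map_source hx.2)
      (hΩ.smooth _ hψ).mbC1On (fun y hy v => ⟨fun a b => ?_, fun c a => ?_⟩)
      (fun y hy u => ⟨fun a b => ?_, fun c a => ?_⟩) (fun y hy u v => ?_)
      (hΩ.closed _ hψ) hx₀ (fieldInChart_leftInvariantField_one hG)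
      (hasDirDeriv_dirDeriv_fieldInChart hG)
      (fun ξ η x hx => formInChart_orbitMapInChart hG hM hact m ξ η hx) ξ η ζ
    · simp only [formInChart, (hT y hy).map_add, map_add, LinearMap.add_apply]
    · simp only [formInChart, (hT y hy).map_smul, map_smul, LinearMap.smul_apply]
    · simp only [formInChart, (hT y hy).map_add, map_add]
    · simp only [formInChart, (hT y hy).map_smul, map_smul]
    · exact (LinearMap.IsAlt.neg (B := Ω _) (hΩ.alternating _) _ _).symm.trans (by rfl)

end Manifolds

/-! ### Complex linear extension and the Kähler case. -/

section Kahler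

variable {V W : Type*} [AddCommGroup V] [Module ℝ V] [AddCommGroup W] [Module ℝ W] [Module ℂ W]
  [IsScalarTower ℝ ℂ W]

/-- The complex linear extension to the complexification of a real linear map into a complex vector
space. -/
def Complexified.lift (A : V → W) (hA : IsLinearMap ℝ A) : Complexified V →ₗ[ℂ] W where
  toFun a := A a.1 + Complex.I • A a.2
  map_add' a b := by
    change A (a.1 + b.1) + Complex.I • A (a.2 + b.2) = _
    rw [hA.map_add, hA.map_add]
    module
  map_smul' z a := by
    change A (z.re • a.1 - z.im • a.2) + Complex.I • A (z.re • a.2 + z.im • a.1) = _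
    have hz : ∀ (r : ℝ) (w : W), r • w = (r : ℂ) • w := fun r w => (algebraMap_smul ℂ r w).symm
    rw [hA.map_sub, hA.map_add, hA.map_smul, hA.map_smul, hA.map_smul, hA.map_smul]
    simp only [hz, RingHom.id_apply]
    -- The fifth `z` is the scalar on the right-hand side; the others sit inside real and imaginary
    -- parts.
    nth_rw 5 [← Complex.re_add_im z]
    match_scalars
    · ring
    · linear_combination -(z.im : ℂ) * Complex.I_sq

theorem Complexified.lift_ofReal (A : V → W) (hA : IsLinearMap ℝ A) (v : V) :
    Complexified.lift A hA (Complexified.ofReal v) = A v := by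
  change A v + Complex.I • A 0 = A v
  rw [hA.map_zero, smul_zero, add_zero]

theorem Complexified.continuous_lift [TopologicalSpace V] [TopologicalSpace W]
    [IsTopologicalAddGroup W] [ContinuousSMul ℂ W] {A : V → W} (hA : IsLinearMap ℝ A)
    (hc : Continuous A) : Continuous (Complexified.lift A hA) := by
  have h : Continuous fun a : V × V => A a.1 + Complex.I • A a.2 := by fun_prop
  exact h

end Kahler

theorem mainTheorem9
    {𝔤 : Type*} [AddCommGroup 𝔤] [Module ℝ 𝔤] [TopologicalSpace 𝔤] [IsTopologicalAddGroup 𝔤]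
    [ContinuousSMul ℝ 𝔤] [LocallyConvexSpace ℝ 𝔤] [T2Space 𝔤]
    {E : Type*} [AddCommGroup E] [Module ℝ E] [TopologicalSpace E] [IsTopologicalAddGroup E]
    [ContinuousSMul ℝ E] [LocallyConvexSpace ℝ E] [T2Space E]
    {G : Type*} [TopologicalSpace G] [ChartedSpace 𝔤 G] [Group G]
    {M : Type*} [TopologicalSpace M] [ChartedSpace E M] [MulAction G M]
    (hG : IsLCLieGroup 𝔤 G)
    (hM : IsLCManifold ℝ E M)
    (Ω : (m : M) → LCTangent E m →ₗ[ℝ] LCTangent E m →ₗ[ℝ] ℝ)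
    (hΩ : IsSymplecticForm Ω)
    (hact : IsSymplecticAction 𝔤 G Ω)
    (m : M) :
    IsContinuousTwoCocycle (lieAlgBracket (𝔤 := 𝔤) G) (kostantSouriau (𝔤 := 𝔤) G Ω m) ∧
    ∀ [Module ℂ E] [IsScalarTower ℝ ℂ E] [ContinuousSMul ℂ E],
      IsKahler Ω →
      ∃ h : Complexified 𝔤 →ₗ⋆[ℂ] Complexified 𝔤 →ₗ[ℂ] ℂ,
        Continuous (fun p : Complexified 𝔤 × Complexified 𝔤 => h p.1 p.2) ∧
        (∀ a b, h b a = conj (h a b)) ∧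
        (∀ a, 0 ≤ (h a a).re) ∧
        (∀ ξ η : 𝔤, kostantSouriau (𝔤 := 𝔤) G Ω m ξ η =
          (h (Complexified.ofReal ξ) (Complexified.ofReal η)).im) := by
  refine ⟨isContinuousTwoCocycle_kostantSouriau hG hM hΩ hact m, ?_⟩
  intro _ _ _ hK
  obtain ⟨-, -, H, hHs, hHc, hHp, hHΩ⟩ := hK
  have hx₀ : chartAt 𝔤 (1 : G) 1 ∈ orbitMapDomain E 𝔤 G m := chartAt_one_mem_orbitMapDomain m
  have hF := (hact.mbSmoothOn_orbitMapInChart m).mbC1On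
  have hX : IsLinearMap ℝ (fun ξ : 𝔤 => (fundamentalField (G := G) ξ m : E)) :=
    hF.isLinearMap_dirDeriv (hact.isOpen_orbitMapDomain m) hx₀
  have hXc : Continuous (fun ξ : 𝔤 => (fundamentalField (G := G) ξ m : E)) :=
    hF.continuous_dirDeriv hx₀
  have hL := Complexified.continuous_lift hX hXc
  set L := Complexified.lift (fun ξ : 𝔤 => (fundamentalField (G := G) ξ m : E)) hX with hLdef
  refine ⟨LinearMap.mk₂'ₛₗ (starRingEnd ℂ) (RingHom.id ℂ) (fun a b => H m (L a) (L b))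
    (fun a a' b => by rw [map_add, map_add, LinearMap.add_apply])
    (fun c a b => by rw [map_smul, map_smulₛₗ, LinearMap.smul_apply])
    (fun a b b' => by rw [map_add, map_add])
    (fun c a b => by rw [map_smul, map_smul, RingHom.id_apply]), ?_, ?_, ?_, ?_⟩
  · exact (continuous_form_of_mbSmoothOn (fun m u v => H m u v) m
      (hHs _ (chart_mem_atlas E m))).comp
        ((hL.comp continuous_fst).prodMk (hL.comp continuous_snd))
  · exact fun a b => hHc m _ _
  · intro a
    change 0 ≤ (H m (L a) (L a)).re
    -- `L` may have a kernel, so positive definiteness of `H` gives only semidefiniteness of the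
    -- pullback.
    rcases eq_or_ne (L a) 0 with h0 | h0
    · rw [h0, map_zero, Complex.zero_re]
    · exact (hHp m _ h0).le
  · intro ξ η
    change _ = (H m (L (Complexified.ofReal ξ)) (L (Complexified.ofReal η))).im
    rw [hLdef, Complexified.lift_ofReal, Complexified.lift_ofReal]
    exact hHΩ m _ _
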